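/- For $n\ge 1$ let $\mathcal{MB}_n$ be the monoid of positive braids on $n$ strands, i.e. the monoid generated by $x_1,\dots,x_{n-1}$ with relations $x_ix_j=x_jx_i$ for $|i-j|\ge 2$ and $x_ix_{i+1}x_i=x_{i+1}x_ix_{i+1}$ for $1\le i\le n-2$. The length of a positive braid is the number of letters in any word representing it. Let $\Delta_n=x_1(x_2x_1)\cdots(x_{n-1}x_{n-2}\cdots x_1)$ be the Garside braid, and let $\mathrm{Div}(\Delta_n)=\{\omega\in\mathcal{MB}_n : \Delta_n=\alpha\omega\beta \text{ for some } \alpha,\beta\in\mathcal{MB}_n\}$ be its set of divisors. For $i\in\mathbb Z$ let $d_{n,i}$ be the number of elements of $\mathrm{Div}(\Delta_n)$ of length $i$ (so $d_{n,i}=0$ for $i<0$). For every $n\ge 1$, the sequence $(d_{n,i})_{0\le i\le n(n-1)/2}$ is symmetric, i.e. $d_{n,i}=d_{n,\,n(n-1)/2-i}$ for $0\le i\le n(n-1)/2$, and unimodal, i.e. there is an $m$ with $0\le m\le n(n-1)/2$ such that $d_{n,0}\le d_{n,1}\le\dots\le d_{n,m}\ge d_{n,m+1}\ge\dots\ge d_{n,n(n-1)/2}$.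 Moreover, these numbers satisfy: a) $d_{1,0}=1$, and $d_{1,i}=0$ for all integers $i\ne 0$; b) $d_{n+1,i}=d_{n,i}+d_{n,i-1}+\dots+d_{n,i-n}$ for all $n\ge 1$ and all $i\in\mathbb Z$. -/

import Mathlib

/-- The defining relations of positive braids on `n` strands, on the letters
`x_1, …, x_{n-1}`; the letter `x_{i+1}` is represented by the index `i : Fin (n - 1)`. -/
inductive BraidRel (n : ℕ) : FreeMonoid (Fin (n - 1)) → FreeMonoid (Fin (n - 1)) → Prop
  | comm (i j : Fin (n - 1)) (h : (i : ℕ) + 2 ≤ j ∨ (j : ℕ) + 2 ≤ i) :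
      BraidRel n (FreeMonoid.of i * FreeMonoid.of j) (FreeMonoid.of j * FreeMonoid.of i)
  | braid (i j : Fin (n - 1)) (h : (j : ℕ) = i + 1) :
      BraidRel n (FreeMonoid.of i * FreeMonoid.of j * FreeMonoid.of i)
        (FreeMonoid.of j * FreeMonoid.of i * FreeMonoid.of j)

/-- The monoid of positive braids on `n` strands. -/
abbrev PositiveBraid (n : ℕ) : Type := PresentedMonoid (BraidRel n)

namespace PositiveBraid

/-- The generator `x_{i+1}`. -/
def gen (n : ℕ) (i : Fin (n - 1)) : PositiveBraid n := PresentedMonoid.of (BraidRel n) i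

theorem lengthHom_rel (n : ℕ) (a b : FreeMonoid (Fin (n - 1))) (h : BraidRel n a b) :
    FreeMonoid.lift (fun _ : Fin (n - 1) => Multiplicative.ofAdd (1 : ℕ)) a =
      FreeMonoid.lift (fun _ : Fin (n - 1) => Multiplicative.ofAdd (1 : ℕ)) b := by
  cases h <;> simp

/-- The length of a positive braid as a monoid homomorphism sending each generator to `1`. -/
def lengthHom (n : ℕ) : PositiveBraid n →* Multiplicative ℕ :=
  PresentedMonoid.lift (fun _ => Multiplicative.ofAdd 1) (lengthHom_rel n)

/-- The length of a positive braid: the number of letters of any word representing it. -/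
def length {n : ℕ} (ω : PositiveBraid n) : ℕ := Multiplicative.toAdd (lengthHom n ω)

/-- Each word representing `ω` has exactly `length ω` letters. -/
theorem length_mk {n : ℕ} (w : FreeMonoid (Fin (n - 1))) :
    length (PresentedMonoid.mk (BraidRel n) w) = w.length := by
  induction w with
  | one => simp [length]
  | of x =>
    simp only [FreeMonoid.length_of]
    rfl
  | mul x y hx hy =>
    simp only [length, map_mul, toAdd_mul, FreeMonoid.length_mul] at hx hy ⊢
    rw [hx, hy]

/-- The descending product `x_{k+1} x_k ⋯ x_1`. -/
def descending (n : ℕ) (k : Fin (n - 1)) : PositiveBraid n :=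
  (List.ofFn fun j : Fin ((k : ℕ) + 1) => gen n ⟨(k : ℕ) - j, by omega⟩).prod

/-- The Garside braid `Δ_n = x_1 (x_2 x_1) ⋯ (x_{n-1} x_{n-2} ⋯ x_1)`. -/
def garside (n : ℕ) : PositiveBraid n := (List.ofFn (descending n)).prod

/-- The set `Div(Δ_n)` of positive braids which are factors of `Δ_n`. -/
def garsideDivisors (n : ℕ) : Set (PositiveBraid n) :=
  {ω | ∃ α β : PositiveBraid n, garside n = α * ω * β}

/-- There are finitely many factors of `Δ_n`. -/
theorem garsideDivisors_finite (n : ℕ) : (garsideDivisors n).Finite := by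
  refine ((List.finite_length_le (Fin (n - 1)) (length (garside n))).image
    fun l => PresentedMonoid.mk (BraidRel n) (FreeMonoid.ofList l)).subset ?_
  rintro ω ⟨α, β, h⟩
  obtain ⟨w, rfl⟩ := PresentedMonoid.surjective_mk ω
  refine ⟨FreeMonoid.toList w, ?_, by simp⟩
  have h1 : length (garside n) =
      length α + length (PresentedMonoid.mk (BraidRel n) w) + length β := by
    rw [h]
    simp [length]
  rw [length_mk] at h1
  have h2 : w.length ≤ length (garside n) := by omega
  exact h2

/-- `divisorCount n i` is the number `d_{n,i}` of divisors of `Δ_n` of length `i`; the index `i` is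
an integer, so this is `0` for negative `i`. -/
noncomputable def divisorCount (n : ℕ) (i : ℤ) : ℕ :=
  {ω ∈ garsideDivisors n | (length ω : ℤ) = i}.ncard

end PositiveBraid

namespace PositiveBraid

open Finset

/-! The divisors of `Δ_n` are the products of descending runs, one for each `m < n`: the run for `m`
starts at index `m - 1` and has `c ≤ m` letters. The list of the `c`'s is the code.

Multiplying such a product by a generator on the right yields another one or creates a repeated
letter (`ofCode_mul_natGen`), so every positive braid has a code or contains a square. A divisor of
`Δ_n` contains no square: `Δ_n` reverses the strands, so its length equals its number of inversions,
whereas deleting a square keeps the permutation and shortens the word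
(`not_hasSquare_of_mem_garsideDivisors`). Conversely every coded braid left-divides `Δ_n`, and the
permutation determines the code.

Length is the sum of the code, so splitting off the free top entry gives the recurrence. Symmetry
and unimodality follow by induction, since sums over a sliding window preserve them. -/

/-- The generators indexed by all naturals, with value `1` outside the range. -/
noncomputable def natGen (n i : ℕ) : PositiveBraid n :=
  if h : i < n - 1 then gen n ⟨i, h⟩ else 1

theorem natGen_of_lt {n i : ℕ} (h : i < n - 1) : natGen n i = gen n ⟨i, h⟩ := dif_pos h

theorem induction_mul_gen {n : ℕ} {p : PositiveBraid n → Prop} (one : p 1)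
    (mul_gen : ∀ ω i, i + 1 < n → p ω → p (ω * natGen n i)) (ω : PositiveBraid n) : p ω := by
  obtain ⟨w, rfl⟩ := PresentedMonoid.surjective_mk ω
  obtain ⟨l, rfl⟩ := FreeMonoid.ofList.surjective w
  induction l using List.reverseRecOn with
  | nil => exact one
  | append_singleton l i ih =>
    have := mul_gen _ i (by omega) ih
    rw [natGen_of_lt i.2] at this
    rw [FreeMonoid.ofList_append, map_mul]
    exact this

theorem length_one (n : ℕ) : length (1 : PositiveBraid n) = 0 := by simp [length]

theorem length_mul {n : ℕ} (a b : PositiveBraid n) : length (a * b) = length a + length b := by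
  simp [length]

theorem length_natGen {n i : ℕ} (h : i + 1 < n) : length (natGen n i) = 1 := by
  rw [natGen_of_lt (by omega)]; rfl

theorem natGen_comm {n i j : ℕ} (hi : i + 1 < n) (hj : j + 1 < n) (h : i + 2 ≤ j ∨ j + 2 ≤ i) :
    natGen n i * natGen n j = natGen n j * natGen n i := by
  rw [natGen_of_lt (by omega), natGen_of_lt (by omega)]
  exact PresentedMonoid.mk_eq_mk_of_rel (BraidRel.comm _ _ h)

theorem natGen_braid {n i : ℕ} (h : i + 2 < n) :
    natGen n i * natGen n (i + 1) * natGen n i =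
      natGen n (i + 1) * natGen n i * natGen n (i + 1) := by
  rw [natGen_of_lt (by omega), natGen_of_lt (by omega)]
  exact PresentedMonoid.mk_eq_mk_of_rel (BraidRel.braid _ _ rfl)

/-! ### Descending runs -/

/-- The product of the `c` generators of indices `m - 1, m - 2, …, m - c`. -/
noncomputable def run (n m c : ℕ) : PositiveBraid n :=
  ((List.range c).map fun j => natGen n (m - 1 - j)).prod

theorem run_zero (n m : ℕ) : run n m 0 = 1 := rfl

theorem run_succ (n m c : ℕ) : run n m (c + 1) = run n m c * natGen n (m - 1 - c) :=
  List.prod_range_succ _ _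

theorem length_run {n m c : ℕ} (hm : m < n) (hc : c ≤ m) : length (run n m c) = c := by
  induction c with
  | zero => exact length_one n
  | succ c ih => rw [run_succ, length_mul, ih (by omega), length_natGen (by omega)]

theorem run_mul_natGen_of_lt {n m c i : ℕ} (hm : m < n) (hc : c ≤ m) (hi : i + 1 < m - c) :
    run n m c * natGen n i = natGen n i * run n m c := by
  induction c with
  | zero => simp [run_zero]
  | succ c ih =>
    rw [run_succ, mul_assoc, natGen_comm (by omega) (by omega) (by omega), ← mul_assoc,
      ih (by omega) (by omega), mul_assoc]

/-- The letter `j + 1` commutes left past the low end of the run until it meets `x_{j+1} x_j`. The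
braid relation then produces a leading letter `j`, which commutes with the remaining, higher
letters. -/
theorem run_mul_natGen_succ {n m c j : ℕ} (hm : m < n) (hc : c ≤ m) (hj : m - c ≤ j)
    (hjm : j + 1 < m) : run n m c * natGen n (j + 1) = natGen n j * run n m c := by
  induction c with
  | zero => omega
  | succ c ih =>
    rcases Nat.lt_or_ge j (m - c) with h | h
    · obtain ⟨d, rfl⟩ : ∃ d, c = d + 1 := ⟨c - 1, by omega⟩
      rw [run_succ, run_succ, show m - 1 - (d + 1) = j by omega, show m - 1 - d = j + 1 by omega]
      calc run n m d * natGen n (j + 1) * natGen n j * natGen n (j + 1)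
          = run n m d * (natGen n (j + 1) * natGen n j * natGen n (j + 1)) := by
            simp only [mul_assoc]
        _ = run n m d * natGen n j * natGen n (j + 1) * natGen n j := by
            rw [← natGen_braid (by omega)]; simp only [mul_assoc]
        _ = _ := by
            rw [run_mul_natGen_of_lt hm (by omega) (by omega)]; simp only [mul_assoc]
    · rw [run_succ, mul_assoc, natGen_comm (by omega) (by omega) (by omega), ← mul_assoc,
        ih (by omega) h, mul_assoc]

/-! ### Normal forms -/

/-- `IsCode l` says that the `k`-th entry from the end of `l` is at most `k`. -/
def IsCode : List ℕ → Prop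
  | [] => True
  | c :: l => c ≤ l.length ∧ IsCode l

/-- The braid with a given code: a product of descending runs. -/
noncomputable def ofCode (n : ℕ) : List ℕ → PositiveBraid n
  | [] => 1
  | c :: l => ofCode n l * run n l.length c

theorem length_ofCode {n : ℕ} {l : List ℕ} (hl : IsCode l) (hn : l.length ≤ n) :
    length (ofCode n l) = l.sum := by
  induction l with
  | nil => exact length_one n
  | cons c l ih =>
    rw [List.length_cons] at hn
    rw [ofCode, length_mul, length_run (by omega) hl.1, ih hl.2 (by omega), List.sum_cons, add_comm]

/-- The braid has a representing word in which some letter occurs twice in a row. -/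
def HasSquare {n : ℕ} (ω : PositiveBraid n) : Prop :=
  ∃ (u v : PositiveBraid n) (i : ℕ), i + 1 < n ∧ ω = u * natGen n i * natGen n i * v

theorem HasSquare.mul_right {n : ℕ} {ω : PositiveBraid n} (h : HasSquare ω)
    (β : PositiveBraid n) : HasSquare (ω * β) := by
  obtain ⟨u, v, i, hi, rfl⟩ := h
  exact ⟨u, v * β, i, hi, by simp only [mul_assoc]⟩

/-- Against the last run, of top index `m - 1` and lowest index `m - c`, the new letter `i` commutes
through if `i + 1 < m - c`, extends the run if `i + 1 = m - c`, makes a square if `i = m - c`, and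
passes through as `i - 1` if larger. When it passes through, the shorter code absorbs it
inductively. -/
theorem ofCode_mul_natGen {n : ℕ} {l : List ℕ} (hl : IsCode l) (hn : l.length ≤ n) {i : ℕ}
    (hi : i + 1 < l.length) :
    (∃ l', IsCode l' ∧ l'.length = l.length ∧ ofCode n l * natGen n i = ofCode n l') ∨
      HasSquare (ofCode n l * natGen n i) := by
  induction l generalizing i with
  | nil => simp at hi
  | cons c t ih =>
    rw [List.length_cons] at hn hi
    obtain ⟨hc, ht⟩ := hl
    have key : ∀ j, j + 1 < t.length →
        run n t.length c * natGen n i = natGen n j * run n t.length c →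
        (∃ l', IsCode l' ∧ l'.length = (c :: t).length ∧
          ofCode n (c :: t) * natGen n i = ofCode n l') ∨
          HasSquare (ofCode n (c :: t) * natGen n i) := by
      intro j hj h
      have h2 : ofCode n (c :: t) * natGen n i
          = ofCode n t * natGen n j * run n t.length c := by
        rw [ofCode, mul_assoc, h, mul_assoc]
      rw [h2]
      rcases ih ht (by omega) hj with ⟨l', h1, h3, h4⟩ | h1
      · refine Or.inl ⟨c :: l', ⟨by omega, h1⟩, by simp [h3], ?_⟩
        rw [h4, ofCode, h3]
      · exact Or.inr (h1.mul_right _)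
    rcases Nat.lt_trichotomy i (t.length - c) with h | h | h
    · rcases Nat.lt_or_ge (i + 1) (t.length - c) with h' | h'
      · exact key i (by omega) (run_mul_natGen_of_lt (by omega) hc h')
      · refine Or.inl ⟨(c + 1) :: t, ⟨by omega, ht⟩, rfl, ?_⟩
        rw [ofCode, ofCode, run_succ, mul_assoc, show t.length - 1 - c = i by omega]
    · obtain ⟨d, rfl⟩ : ∃ d, c = d + 1 := ⟨c - 1, by omega⟩
      refine Or.inr ⟨ofCode n t * run n t.length d, 1, i, by omega, ?_⟩
      rw [ofCode, run_succ, show t.length - 1 - d = i by omega]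
      simp only [mul_assoc, mul_one]
    · obtain ⟨j, rfl⟩ : ∃ j, i = j + 1 := ⟨i - 1, by omega⟩
      exact key j (by omega) (run_mul_natGen_succ (by omega) hc (by omega) (by omega))

theorem isCode_replicate_zero (n : ℕ) : IsCode (List.replicate n 0) := by
  induction n with
  | zero => trivial
  | succ n ih => exact ⟨Nat.zero_le _, ih⟩

theorem ofCode_replicate_zero (n m : ℕ) : ofCode n (List.replicate m 0) = 1 := by
  induction m with
  | zero => rfl
  | succ m ih => rw [List.replicate_succ, ofCode, ih, run_zero, one_mul]

theorem exists_code_or_hasSquare {n : ℕ} (ω : PositiveBraid n) :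
    (∃ l, IsCode l ∧ l.length = n ∧ ω = ofCode n l) ∨ HasSquare ω := by
  induction ω using induction_mul_gen with
  | one =>
    exact Or.inl ⟨_, isCode_replicate_zero n, by simp, (ofCode_replicate_zero n n).symm⟩
  | mul_gen ω i hi ih =>
    rcases ih with ⟨l, hl, hn, rfl⟩ | h
    · rcases ofCode_mul_natGen hl hn.le (by omega : i + 1 < l.length) with ⟨l', h1, h2, h3⟩ | h
      · exact Or.inl ⟨l', h1, h2.trans hn, h3⟩
      · exact Or.inr h
    · exact Or.inr (h.mul_right _)

/-! ### The Garside braid -/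

/-- The Garside braid on the first `m` of `n` strands. -/
noncomputable def partialGarside (n m : ℕ) : PositiveBraid n :=
  ((List.range m).map fun k => run n k k).prod

theorem partialGarside_succ (n m : ℕ) :
    partialGarside n (m + 1) = partialGarside n m * run n m m :=
  List.prod_range_succ _ _

theorem map_range_eq_ofFn {α : Type*} (f : ℕ → α) (k : ℕ) :
    (List.range k).map f = List.ofFn fun i : Fin k => f i :=
  List.ext_getElem (by simp) (by simp)

theorem garside_eq (n : ℕ) (hn : 1 ≤ n) : garside n = partialGarside n n := by
  obtain ⟨m, rfl⟩ : ∃ m, n = m + 1 := ⟨n - 1, by omega⟩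
  have hd : ∀ k : Fin (m + 1 - 1), descending (m + 1) k = run (m + 1) (k + 1) (k + 1) := by
    intro k
    rw [descending, run, map_range_eq_ofFn]
    congr 2
    funext j
    rw [natGen_of_lt (by omega)]
    congr 2
  -- The empty run at `k = 0` is dropped, which aligns the remaining runs with the `descending`
  -- factors.
  rw [garside, partialGarside, List.range_succ_eq_map, List.map_cons, List.prod_cons, run_zero,
    one_mul, List.map_map, map_range_eq_ofFn]
  congr 2
  funext k
  exact hd k

theorem run_mul_eq_run {n m c : ℕ} (hc : c ≤ m) :
    ∃ E ∈ Submonoid.closure (natGen n '' {i | i < m}), run n m c * E = run n m m := by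
  induction hc using Nat.decreasingInduction with
  | self => exact ⟨1, one_mem _, mul_one _⟩
  | of_succ c hc ih =>
    obtain ⟨E, hE, h⟩ := ih
    refine ⟨natGen n (m - 1 - c) * E, mul_mem (Submonoid.subset_closure ⟨_, ?_, rfl⟩) hE, ?_⟩
    · simp only [Set.mem_ofPred_eq]; omega
    · rw [← mul_assoc, ← run_succ, h]

theorem mul_run_eq_run_mul {n m : ℕ} (hm : m < n) {V : PositiveBraid n}
    (hV : V ∈ Submonoid.closure (natGen n '' {i | i + 1 < m})) :
    ∃ V' ∈ Submonoid.closure (natGen n '' {i | i < m}), V * run n m m = run n m m * V' := by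
  induction hV using Submonoid.closure_induction with
  | mem x hx =>
    obtain ⟨i, hi, rfl⟩ := hx
    exact ⟨natGen n (i + 1), Submonoid.subset_closure ⟨_, hi, rfl⟩,
      (run_mul_natGen_succ hm le_rfl (by omega) hi).symm⟩
  | one => exact ⟨1, one_mem _, by simp⟩
  | mul x y _ _ hx hy =>
    obtain ⟨x', hx', ex⟩ := hx
    obtain ⟨y', hy', ey⟩ := hy
    exact ⟨x' * y', mul_mem hx' hy', by rw [mul_assoc, ey, ← mul_assoc, ex, mul_assoc]⟩

/-- Completing the last run lets the cofactor of the shorter code be pushed through it, raising each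
letter by one. The bound on the letters of `V` is what permits this push. -/
theorem ofCode_dvd_partialGarside {n : ℕ} {l : List ℕ} (hl : IsCode l) (hn : l.length ≤ n) :
    ∃ V ∈ Submonoid.closure (natGen n '' {i | i + 1 < l.length}),
      ofCode n l * V = partialGarside n l.length := by
  induction l with
  | nil => exact ⟨1, one_mem _, mul_one _⟩
  | cons c t ih =>
    rw [List.length_cons] at hn
    obtain ⟨V, hV, h⟩ := ih hl.2 (by omega)
    obtain ⟨E, hE, hE'⟩ := run_mul_eq_run (n := n) hl.1
    obtain ⟨V', hV', h'⟩ := mul_run_eq_run_mul (by omega) hV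
    simp only [List.length_cons, Nat.add_lt_add_iff_right]
    refine ⟨E * V', mul_mem hE hV', ?_⟩
    rw [ofCode, mul_assoc, ← mul_assoc _ E, hE', ← h', ← mul_assoc, h, partialGarside_succ]

theorem length_partialGarside {n m : ℕ} (hm : m ≤ n) :
    length (partialGarside n m) = ∑ k ∈ range m, k := by
  induction m with
  | zero => exact length_one n
  | succ m ih =>
    rw [partialGarside_succ, length_mul, ih (by omega), length_run hm le_rfl, sum_range_succ]

/-! ### The underlying permutation -/

/-- The adjacent transposition of `i` and `i + 1`. -/
def adjSwap (i : ℕ) : Equiv.Perm ℕ := Equiv.swap i (i + 1)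

theorem adjSwap_apply (i x : ℕ) :
    adjSwap i x = if x = i then i + 1 else if x = i + 1 then i else x :=
  Equiv.swap_apply_def _ _ _

theorem adjSwap_comm {i j : ℕ} (h : i + 2 ≤ j ∨ j + 2 ≤ i) :
    adjSwap i * adjSwap j = adjSwap j * adjSwap i := by
  ext x
  simp only [Equiv.Perm.mul_apply, adjSwap_apply]
  split_ifs <;> omega

theorem adjSwap_braid (i : ℕ) :
    adjSwap i * adjSwap (i + 1) * adjSwap i = adjSwap (i + 1) * adjSwap i * adjSwap (i + 1) := by
  ext x
  simp only [Equiv.Perm.mul_apply, adjSwap_apply]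
  split_ifs <;> omega

theorem adjSwap_rel (n : ℕ) (a b : FreeMonoid (Fin (n - 1))) (h : BraidRel n a b) :
    FreeMonoid.lift (fun i : Fin (n - 1) => adjSwap i) a =
      FreeMonoid.lift (fun i : Fin (n - 1) => adjSwap i) b := by
  cases h with
  | comm i j h =>
    rw [map_mul, map_mul]
    exact adjSwap_comm h
  | braid i j h =>
    simp only [map_mul, FreeMonoid.lift_eval_of, h]
    exact adjSwap_braid i

/-- The permutation of strand positions induced by a positive braid. -/
def perm (n : ℕ) : PositiveBraid n →* Equiv.Perm ℕ :=
  PresentedMonoid.lift (fun i : Fin (n - 1) => adjSwap i) (adjSwap_rel n)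

theorem perm_natGen {n i : ℕ} (h : i + 1 < n) : perm n (natGen n i) = adjSwap i := by
  rw [natGen_of_lt (by omega)]; rfl

theorem perm_run_apply {n m c : ℕ} (hm : m < n) (hc : c ≤ m) (x : ℕ) :
    perm n (run n m c) x = if x = m - c then m else if m - c < x ∧ x ≤ m then x - 1 else x := by
  induction c generalizing x with
  | zero =>
    rw [run_zero, map_one, Equiv.Perm.one_apply]
    split_ifs <;> omega
  | succ c ih =>
    rw [run_succ, map_mul, perm_natGen (by omega), Equiv.Perm.mul_apply, ih (by omega),
      adjSwap_apply]
    split_ifs <;> omega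

theorem perm_ofCode_apply_of_le {n : ℕ} {l : List ℕ} (hl : IsCode l) (hn : l.length ≤ n) {x : ℕ}
    (hx : l.length ≤ x) : perm n (ofCode n l) x = x := by
  induction l with
  | nil => simp [ofCode]
  | cons c t ih =>
    rw [List.length_cons] at hn hx
    have := hl.1
    rw [ofCode, map_mul, Equiv.Perm.mul_apply, perm_run_apply (by omega) hl.1, if_neg (by omega),
      if_neg (by omega), ih hl.2 (by omega) (by omega)]

/-- The top entry `c` can be read off: `m - c` is the position sent to `m`, because the last run
sends it there and the shorter code fixes `m`. -/
theorem perm_ofCode_injective {n : ℕ} {l l' : List ℕ} (hl : IsCode l) (hl' : IsCode l')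
    (hn : l.length ≤ n) (hll : l.length = l'.length)
    (h : perm n (ofCode n l) = perm n (ofCode n l')) : l = l' := by
  induction l generalizing l' with
  | nil => exact (List.length_eq_zero_iff.1 hll.symm).symm
  | cons c t ih =>
    cases l' with
    | nil => simp at hll
    | cons c' t' =>
      rw [List.length_cons] at hn
      simp only [List.length_cons, Nat.add_right_cancel_iff] at hll
      obtain ⟨hc, ht⟩ := hl
      obtain ⟨hc', ht'⟩ := hl'
      simp only [ofCode, map_mul, ← hll] at h
      rw [← hll] at hc'
      have hcc : c = c' := by
        have h1 := congrArg (fun σ : Equiv.Perm ℕ => σ (t.length - c)) h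
        simp only [Equiv.Perm.mul_apply] at h1
        rw [perm_run_apply (by omega) hc, if_pos rfl,
          perm_ofCode_apply_of_le ht (by omega) le_rfl] at h1
        nth_rewrite 1 [← perm_ofCode_apply_of_le (n := n) ht' (by omega) hll.ge] at h1
        have h2 := (perm n (ofCode n t')).injective h1
        rw [perm_run_apply (by omega) hc'] at h2
        split_ifs at h2 <;> omega
      subst hcc
      rw [ih ht ht' (by omega) hll (mul_right_cancel h)]

theorem perm_partialGarside_apply {n m : ℕ} (hm : m ≤ n) (x : ℕ) :
    perm n (partialGarside n m) x = if x < m then m - 1 - x else x := by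
  induction m generalizing x with
  | zero => simp [partialGarside]
  | succ m ih =>
    rw [partialGarside_succ, map_mul, Equiv.Perm.mul_apply, perm_run_apply hm le_rfl,
      ih (by omega)]
    split_ifs <;> omega

/-- The number of inversions of a permutation among the positions `0, …, n - 1`. -/
def inversions (n : ℕ) (σ : Equiv.Perm ℕ) : ℕ :=
  #{p ∈ (range n).sigma range | σ p.1 < σ p.2}

/-- Swapping positions carries each inversion of the product, except possibly the pair `(k + 1, k)`,
to an inversion of `σ`. -/
theorem inversions_mul_adjSwap_le {n k : ℕ} (hk : k + 1 < n) (σ : Equiv.Perm ℕ) :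
    inversions n (σ * adjSwap k) ≤ inversions n σ + 1 := by
  refine (card_le_card (t := insert ⟨k + 1, k⟩
    (image (fun p : (_ : ℕ) × ℕ => (⟨adjSwap k p.1, adjSwap k p.2⟩ : (_ : ℕ) × ℕ))
      {p ∈ (range n).sigma range | σ p.1 < σ p.2})) ?_).trans
    ((card_insert_le _ _).trans (Nat.add_le_add_right card_image_le 1))
  rintro ⟨j, i⟩ h
  rw [mem_filter] at h
  simp only [mem_sigma, mem_range, Equiv.Perm.mul_apply] at h
  rw [mem_insert, mem_image]
  by_cases hij : i = k ∧ j = k + 1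
  · obtain ⟨rfl, rfl⟩ := hij
    exact Or.inl rfl
  · refine Or.inr ⟨⟨adjSwap k j, adjSwap k i⟩, ?_, by simp [adjSwap]⟩
    simp only [mem_filter, mem_sigma, mem_range]
    refine ⟨?_, h.2⟩
    simp only [adjSwap_apply]
    split_ifs <;> omega

theorem inversions_perm_le_length {n : ℕ} (ω : PositiveBraid n) :
    inversions n (perm n ω) ≤ length ω := by
  induction ω using induction_mul_gen with
  | one =>
    rw [map_one, length_one, inversions, Nat.le_zero, card_eq_zero, filter_eq_empty_iff]
    rintro ⟨j, i⟩ h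
    simp only [mem_sigma, mem_range] at h
    simp only [Equiv.Perm.one_apply]
    omega
  | mul_gen ω i hi ih =>
    rw [map_mul, perm_natGen hi, length_mul, length_natGen hi]
    exact (inversions_mul_adjSwap_le hi _).trans (Nat.add_le_add_right ih 1)

theorem inversions_perm_partialGarside (n : ℕ) :
    inversions n (perm n (partialGarside n n)) = length (partialGarside n n) := by
  rw [length_partialGarside le_rfl, inversions, filter_true_of_mem, card_sigma]
  · simp
  · rintro ⟨j, i⟩ h
    simp only [mem_sigma, mem_range] at h
    simp only [perm_partialGarside_apply le_rfl]
    split_ifs <;> omega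

theorem not_hasSquare_of_mem_garsideDivisors {n : ℕ} (hn : 1 ≤ n) {ω : PositiveBraid n}
    (hω : ω ∈ garsideDivisors n) : ¬ HasSquare ω := by
  rintro ⟨u, v, i, hi, rfl⟩
  obtain ⟨α, β, h⟩ := hω
  rw [garside_eq n hn] at h
  have h1 := inversions_perm_partialGarside n
  have h2 := inversions_perm_le_length (α * u * v * β)
  have h3 : perm n (partialGarside n n) = perm n (α * u * v * β) := by
    have hs : adjSwap i * adjSwap i = 1 := Equiv.swap_mul_self _ _
    rw [h]
    simp only [map_mul, perm_natGen hi, mul_assoc]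
    rw [← mul_assoc (adjSwap i), hs, one_mul]
  rw [h3, h] at h1
  simp only [length_mul, length_natGen hi] at h1 h2
  omega

theorem mem_garsideDivisors_iff {n : ℕ} (hn : 1 ≤ n) {ω : PositiveBraid n} :
    ω ∈ garsideDivisors n ↔ ∃ l, IsCode l ∧ l.length = n ∧ ω = ofCode n l := by
  constructor
  · intro h
    exact (exists_code_or_hasSquare ω).resolve_right (not_hasSquare_of_mem_garsideDivisors hn h)
  · rintro ⟨l, hl, hln, rfl⟩
    obtain ⟨V, -, h⟩ := ofCode_dvd_partialGarside hl hln.le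
    rw [hln] at h
    exact ⟨1, V, by rw [garside_eq n hn, one_mul, h]⟩

/-! ### Counting -/

/-- The finite set of codes of a given length. -/
def codes : ℕ → Finset (List ℕ)
  | 0 => {[]}
  | n + 1 => (range (n + 1)).biUnion fun c => (codes n).map ⟨List.cons c, List.cons_injective⟩

theorem mem_codes {n : ℕ} {l : List ℕ} : l ∈ codes n ↔ IsCode l ∧ l.length = n := by
  induction n generalizing l with
  | zero =>
    rw [codes, mem_singleton]
    constructor
    · rintro rfl; exact ⟨trivial, rfl⟩
    · exact fun h => List.length_eq_zero_iff.1 h.2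
  | succ n ih =>
    simp only [codes, mem_biUnion, mem_range, mem_map, Function.Embedding.coeFn_mk, ih]
    constructor
    · rintro ⟨c, hc, t, ⟨ht, rfl⟩, rfl⟩
      exact ⟨⟨by omega, ht⟩, rfl⟩
    · rintro ⟨h, hl⟩
      cases l with
      | nil => simp at hl
      | cons c t =>
        simp only [List.length_cons, Nat.add_right_cancel_iff] at hl
        have := h.1
        exact ⟨c, by omega, t, ⟨h.2, hl⟩, rfl⟩

theorem divisorCount_eq_card_codes {n : ℕ} (hn : 1 ≤ n) (i : ℤ) :
    divisorCount n i = #{l ∈ codes n | ((l.sum : ℕ) : ℤ) = i} := by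
  rw [divisorCount, ← Set.ncard_coe_finset]
  have himage : {ω ∈ garsideDivisors n | (length ω : ℤ) = i} =
      ofCode n '' ({l ∈ codes n | ((l.sum : ℕ) : ℤ) = i} : Finset (List ℕ)) := by
    ext ω
    simp only [Set.mem_ofPred_eq, mem_garsideDivisors_iff hn, coe_filter, Set.mem_image, mem_codes]
    constructor
    · rintro ⟨⟨l, hl, hln, rfl⟩, h⟩
      rw [length_ofCode hl hln.le] at h
      exact ⟨l, ⟨⟨hl, hln⟩, h⟩, rfl⟩
    · rintro ⟨l, ⟨⟨hl, hln⟩, h⟩, rfl⟩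
      exact ⟨⟨l, hl, hln, rfl⟩, by rw [length_ofCode hl hln.le, h]⟩
  rw [himage, Set.InjOn.ncard_image]
  intro l hl l' hl' h
  simp only [coe_filter, Set.mem_ofPred_eq, mem_codes] at hl hl'
  exact perm_ofCode_injective hl.1.1 hl'.1.1 hl.1.2.le (hl.1.2.trans hl'.1.2.symm)
    (congrArg (perm n) h)

theorem divisorCount_one (i : ℤ) : divisorCount 1 i = if i = 0 then 1 else 0 := by
  have h : codes 1 = {[0]} := rfl
  rw [divisorCount_eq_card_codes le_rfl, h, filter_singleton]
  simp only [List.sum_cons, List.sum_nil, add_zero, Nat.cast_zero, eq_comm (a := (0 : ℤ))]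
  split_ifs <;> rfl

theorem divisorCount_succ {n : ℕ} (hn : 1 ≤ n) (i : ℤ) :
    divisorCount (n + 1) i = ∑ k ∈ range (n + 1), divisorCount n (i - k) := by
  rw [divisorCount_eq_card_codes (by omega), codes, filter_biUnion, card_biUnion]
  · refine sum_congr rfl fun k _ => ?_
    rw [divisorCount_eq_card_codes hn, filter_map, card_map]
    congr 1
    refine filter_congr fun l _ => ?_
    simp only [Function.comp_apply, Function.Embedding.coeFn_mk, List.sum_cons, Nat.cast_add]
    constructor <;> intro h <;> linarith
  · intro a _ b _ hab
    rw [Function.onFun, disjoint_left]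
    intro l ha hb
    simp only [mem_filter, mem_map, Function.Embedding.coeFn_mk] at ha hb
    obtain ⟨⟨t, -, rfl⟩, -⟩ := ha
    obtain ⟨⟨t', -, h⟩, -⟩ := hb
    exact hab (List.cons.inj h).1.symm

/-! ### Symmetry and unimodality -/

theorem sum_window_symm {f : ℤ → ℕ} {N : ℤ} (hf : ∀ i, f i = f (N - i)) (n : ℕ) (i : ℤ) :
    ∑ k ∈ range (n + 1), f (i - k) = ∑ k ∈ range (n + 1), f (N + n - i - k) := by
  rw [← sum_range_reflect]
  refine sum_congr rfl fun k hk => ?_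
  rw [mem_range] at hk
  rw [hf, show n + 1 - 1 - k = n - k by omega, Nat.cast_sub (by omega)]
  congr 1
  ring

/-- With symmetry, `hm` expresses unimodality about `N / 2`. Sliding the window one step trades `f
(i - n)` for `f (i + 1)`, a gain as long as `(i - n) + (i + 1) ≤ N`. -/
theorem sum_window_mono {f : ℤ → ℕ} {N : ℤ} (hf : ∀ i, f i = f (N - i))
    (hm : ∀ i j, i ≤ j → i + j ≤ N → f i ≤ f j) (n : ℕ) (i j : ℤ) (hij : i ≤ j)
    (h : i + j ≤ N + n) :
    ∑ k ∈ range (n + 1), f (i - k) ≤ ∑ k ∈ range (n + 1), f (j - k) := by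
  have step : ∀ i : ℤ, 2 * i + 1 ≤ N + n →
      ∑ k ∈ range (n + 1), f (i - k) ≤ ∑ k ∈ range (n + 1), f (i + 1 - k) := by
    intro i hi
    rw [sum_range_succ, sum_range_succ']
    refine Nat.add_le_add (le_of_eq (sum_congr rfl fun k _ => ?_)) (hm _ _ ?_ ?_)
    · congr 1; push_cast; ring
    · push_cast; omega
    · push_cast; omega
  have low : ∀ j, i ≤ j → 2 * j ≤ N + n + 1 →
      ∑ k ∈ range (n + 1), f (i - k) ≤ ∑ k ∈ range (n + 1), f (j - k) := by
    intro j hij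
    induction j, hij using Int.leInduction with
    | base => exact fun _ => le_rfl
    | succ j _ ih => exact fun hj => (ih (by omega)).trans (step j (by omega))
  by_cases hj : 2 * j ≤ N + n + 1
  · exact low j hij hj
  -- Beyond the centre, `j` is reflected to `N + n - j`, which is still at least `i`.
  · rw [sum_window_symm hf n j]
    exact low _ (by omega) (by omega)

theorem divisorCount_symm_and_mono {n : ℕ} (hn : 1 ≤ n) :
    (∀ i, divisorCount n i = divisorCount n (((n * (n - 1) / 2 : ℕ) : ℤ) - i)) ∧
      ∀ i j : ℤ, i ≤ j → i + j ≤ ((n * (n - 1) / 2 : ℕ) : ℤ) →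
        divisorCount n i ≤ divisorCount n j := by
  induction n, hn using Nat.le_induction with
  | base =>
    simp only [divisorCount_one]
    refine ⟨fun i => ?_, fun i j hij h => ?_⟩
    · simp
    · simp only [tsub_self, mul_zero, Nat.zero_div, Nat.cast_zero] at h
      split_ifs <;> omega
  | succ n hn ih =>
    have hN : (n + 1) * (n + 1 - 1) / 2 = n * (n - 1) / 2 + n := by
      rw [← sum_range_id_mul_two, ← sum_range_id_mul_two, Nat.mul_div_cancel _ two_pos,
        Nat.mul_div_cancel _ two_pos, sum_range_succ]
    simp only [divisorCount_succ hn, hN, Nat.cast_add]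
    exact ⟨sum_window_symm ih.1 n, sum_window_mono ih.1 ih.2 n⟩

end PositiveBraid

theorem mainTheorem9 :
    (∀ n : ℕ, 1 ≤ n →
      -- the sequence `d_{n,0}, …, d_{n,n(n-1)/2}` is symmetric
      (∀ i : ℕ, i ≤ n * (n - 1) / 2 →
        PositiveBraid.divisorCount n i =
          PositiveBraid.divisorCount n (((n * (n - 1) / 2 : ℕ) : ℤ) - i)) ∧
      -- and unimodal
      (∃ m : ℕ, m ≤ n * (n - 1) / 2 ∧
        (∀ i j : ℕ, i ≤ j → j ≤ m →
          PositiveBraid.divisorCount n i ≤ PositiveBraid.divisorCount n j) ∧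
        (∀ i j : ℕ, m ≤ i → i ≤ j → j ≤ n * (n - 1) / 2 →
          PositiveBraid.divisorCount n j ≤ PositiveBraid.divisorCount n i))) ∧
    -- the initial values
    PositiveBraid.divisorCount 1 0 = 1 ∧
    (∀ i : ℤ, i ≠ 0 → PositiveBraid.divisorCount 1 i = 0) ∧
    -- the recurrence
    (∀ n : ℕ, 1 ≤ n → ∀ i : ℤ,
      PositiveBraid.divisorCount (n + 1) i =
        ∑ k ∈ Finset.range (n + 1), PositiveBraid.divisorCount n (i - (k : ℤ))) := by
  open PositiveBraid in
  refine ⟨fun n hn => ?_, by simp [divisorCount_one], fun i hi => by simp [divisorCount_one, hi],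
    fun n hn i => divisorCount_succ hn i⟩
  obtain ⟨hs, hm⟩ := divisorCount_symm_and_mono hn
  refine ⟨fun i _ => hs i, n * (n - 1) / 2 / 2, Nat.div_le_self _ _, fun i j hij hj => ?_,
    fun i j hi hij hj => ?_⟩
  · exact hm _ _ (by omega) (by omega)
  -- Reflection needs `i + j ≥ N` for the total length `N`; for odd `N` this fails at `i = j = m`,
  -- but `i < j` gives `i + j ≥ 2 * m + 1 ≥ N`.
  · rcases hij.eq_or_lt with rfl | hij
    · exact le_rfl
    · rw [hs i, hs j]
      exact hm _ _ (by omega) (by omega)
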